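/- Let $(R,\mathfrak m)$ be a Noetherian local ring of Krull dimension $2$ that is Cohen--Macaulay. For an $\mathfrak m$-primary ideal $I$ of $R$ let $\mu(I)$ be its minimal number of generators, let $\ell\ell(I)$ be the smallest integer $k$ such that $\mathfrak m^k\subseteq I$, and let $$e(I)=\lim_{k\to\infty}\frac{2!\,\ell(R/I^k)}{k^2}$$ be its Hilbert--Samuel multiplicity, where $\ell$ denotes length. Say that $I$ satisfies Inequality A if $$(d-1)!\,(\mu(I)-d+1)\,\ell\ell(I)\ \ge\ e(I),\qquad d=\dim R=2,$$ that is, $(\mu(I)-1)\,\ell\ell(I)\ge e(I)$. Then the following conditions are equivalent: (a) $R$ has minimal multiplicity, that is, equality holds in Abhyankar's inequality $e(\mathfrak m)\ge\mu(\mathfrak m)-d+1$; for $d=2$ this says $e(\mathfrak m)=\mu(\mathfrak m)-1$; (b) $\mathfrak m^n$ satisfies Inequality A for all integers $n\ge 1$; (c) $\mathfrak m^n$ satisfies Inequality A for infinitely many integers $n\ge 1$. -/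

import Mathlib

open IsLocalRing Filter

namespace LechIneq

section Defs

variable (R : Type*) [CommRing R]

/-- A (Noetherian) local ring is Cohen-Macaulay if its depth equals its Krull dimension, i.e. if its
maximal ideal contains a regular sequence whose length is the Krull dimension. -/
def IsCohenMacaulay [IsLocalRing R] : Prop :=
  ∃ rs : List R, (∀ r ∈ rs, r ∈ maximalIdeal R) ∧
    RingTheory.Sequence.IsRegular R rs ∧ (rs.length : WithBot ℕ∞) = ringKrullDim R

/-- The Krull dimension `d` of `R` as a natural number (meaningful when it is finite and `R ≠ 0`,
in particular for every Noetherian local ring). -/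
noncomputable def dim : ℕ := ((ringKrullDim R).unbotD 0).toNat

variable {R}

/-- The Hilbert-Samuel multiplicity `e(I) = lim_{n → ∞} d! ℓ(R / I ^ n) / n ^ d`, where `d = dim R`.
For an ideal primary to the maximal ideal of a Noetherian local ring
the lengths are finite and the limit exists. -/
noncomputable def hsMultiplicity (I : Ideal R) : ℝ :=
  limUnder atTop fun n : ℕ ↦
    ((dim R).factorial : ℝ) * ((Module.length R (R ⧸ I ^ n)).toNat : ℝ) / (n : ℝ) ^ dim R

/-- The Loewy length of `R / I`: the smallest `n` such that `𝔪 ^ n ⊆ I`. -/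
noncomputable def loewyLength [IsLocalRing R] (I : Ideal R) : ℕ :=
  sInf {n : ℕ | maximalIdeal R ^ n ≤ I}

/-- The minimal number of generators `μ(I)`. -/
noncomputable def numGens (I : Ideal R) : ℕ := Submodule.spanFinrank I

/-- The inequality `(d - 1)! (μ(I) - d + 1) ℓℓ(I) ≥ e(I)`, where `d = dim R ≥ 1`. -/
def InequalityA [IsLocalRing R] (I : Ideal R) : Prop :=
  ((dim R - 1).factorial : ℝ) * ((numGens I : ℝ) - (dim R : ℝ) + 1) * (loewyLength I : ℝ)
    ≥ hsMultiplicity I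

variable (R)

/-- A Cohen-Macaulay local ring has minimal multiplicity if equality holds in Abhyankar's inequality
`e(R) ≥ μ(𝔪) - d + 1`, where `e(R) = e(𝔪)`. -/
def HasMinimalMultiplicity [IsLocalRing R] : Prop :=
  hsMultiplicity (maximalIdeal R) = (numGens (maximalIdeal R) : ℝ) - (dim R : ℝ) + 1

end Defs

end LechIneq

/-! Write H(n) = ℓ(R/𝔪^n), so that μ(𝔪^n) = H(n+1) - H(n), and suppose that 𝔪 has a reduction J =
(x, y). Depth 2 makes x, y quasi-regular, so ℓ(R/J^n) = e·n(n+1)/2 with e = ℓ(R/J). Comparing powers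
of 𝔪 and J gives e(𝔪^n) = n²e, and ℓℓ(𝔪^n) = n, so Inequality A for 𝔪^n reads μ(𝔪^n) ≥ ne + 1. The
colength of J^n𝔪 + x𝔪^n ⊆ 𝔪^(n+1) (n ≥ 1) gives the opposite bound. Hence Inequality A means
equality, and minimal multiplicity is equality at n = 1.

Equality at n = 1 forces 𝔪² = J𝔪, hence 𝔪^(n+1) = J^n𝔪 and equality for every n. Conversely,
equality at one n beyond the reduction number propagates upward, so ℓ(𝔪^(n+1)/J^n𝔪) is eventually
constant. An element w of 𝔪² outside J𝔪 would make that length at least n, through the products of w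
with the monomials in x, y; so 𝔪² = J𝔪. This is `TrivialSyzygies.hilbertBound`.

Over an infinite residue field J exists (`exists_reduction`), because three independent directions
would make H grow cubically. In general one passes to R(X): colengths are unchanged, and only the
numerical conclusions `HilbertBound` have to return to R (`exists_hilbertBound`). -/

namespace LechIneq

/-! ### Colength bookkeeping -/

section Colength

variable {R : Type*} [CommRing R]

/-- The colength `ℓ(R / I)` of an ideal. -/
noncomputable def colength (I : Ideal R) : ℕ∞ := Module.length R (R ⧸ I)

/-- Exactness of 0 → M/f⁻¹(C) → R/C → R/(C + im f) → 0. All lower bounds on colengths below come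
from controlling f⁻¹(C). -/
theorem colength_eq_add {M : Type*} [AddCommGroup M] [Module R M] (f : M →ₗ[R] R)
    {C B : Ideal R} (h : C ⊔ LinearMap.range f = B) :
    colength C = colength B + Module.length R (M ⧸ Submodule.comap f C) := by
  subst h
  have hCB : C ≤ C ⊔ LinearMap.range f := le_sup_left
  let g : (M ⧸ Submodule.comap f C) →ₗ[R] (R ⧸ C) := Submodule.mapQ _ C f le_rfl
  have hg : Function.Injective g := by
    rw [← LinearMap.ker_eq_bot, Submodule.ker_mapQ, Submodule.mkQ_map_self]
  let q : (R ⧸ C) →ₗ[R] (R ⧸ (C ⊔ LinearMap.range f)) := Submodule.factor hCB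
  have hq : Function.Surjective q := Submodule.factor_surjective hCB
  have hex : Function.Exact g q := by
    rw [LinearMap.exact_iff]
    ext z
    obtain ⟨z, rfl⟩ := Submodule.mkQ_surjective _ z
    have h1 : q (C.mkQ z) = 0 ↔ z ∈ C ⊔ LinearMap.range f := by
      change (Submodule.mkQ (C ⊔ LinearMap.range f)) z = 0 ↔ _
      exact Submodule.Quotient.mk_eq_zero _
    rw [LinearMap.mem_ker, h1, Submodule.mem_sup]
    constructor
    · rintro ⟨a, ha, b, ⟨m, rfl⟩, rfl⟩
      refine ⟨Submodule.mkQ _ m, ?_⟩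
      change C.mkQ (f m) = _
      have : C.mkQ a = 0 := (Submodule.Quotient.mk_eq_zero _).2 ha
      rw [map_add, this, zero_add]
    · rintro ⟨m, hm⟩
      obtain ⟨m, rfl⟩ := Submodule.mkQ_surjective _ m
      change C.mkQ (f m) = C.mkQ z at hm
      refine ⟨z - f m, ?_, f m, ⟨m, rfl⟩, by ring⟩
      rw [← sub_eq_zero, ← map_sub] at hm
      have : f m - z ∈ C := (Submodule.Quotient.mk_eq_zero _).1 hm
      rw [← neg_sub]
      exact C.neg_mem this
  unfold colength
  rw [Module.length_eq_add_of_exact g q hg hq hex, add_comm]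

theorem colength_eq_add_of_le {A B : Ideal R} (h : A ≤ B) :
    colength A = colength B + Module.length R (B ⧸ Submodule.comap B.subtype A) :=
  colength_eq_add B.subtype (by simpa using h)

theorem colength_anti {A B : Ideal R} (h : A ≤ B) : colength B ≤ colength A := by
  rw [colength_eq_add_of_le h]; exact le_self_add

theorem eq_of_le_of_colength_le {A B : Ideal R} (h : A ≤ B) (hA : colength A ≠ ⊤)
    (h' : colength A ≤ colength B) : A = B := by
  have h1 := colength_eq_add_of_le h
  have hB : colength B ≠ ⊤ := ne_top_of_le_ne_top hA (colength_anti h)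
  have h2 : Module.length R (B ⧸ Submodule.comap B.subtype A) = 0 := by
    rw [h1] at h'
    generalize Module.length R (B ⧸ Submodule.comap B.subtype A) = t at *
    generalize colength B = b at *
    lift b to ℕ using hB
    cases t with
    | top => simp at h'
    | coe t => norm_cast at h' ⊢; omega
  rw [Module.length_eq_zero_iff, Submodule.Quotient.subsingleton_iff] at h2
  refine le_antisymm h fun z hz => ?_
  have : (⟨z, hz⟩ : B) ∈ Submodule.comap B.subtype A := h2 ▸ trivial
  simpa using this

/-- Multiplication by x induces an isomorphism B/A ≅ (C + xB)/C. -/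
theorem colength_mul_add (C A B : Ideal R) (hAB : A ≤ B) (x : R)
    (h : ∀ z ∈ B, x * z ∈ C ↔ z ∈ A) :
    colength C + colength B = colength (C ⊔ Ideal.span {x} * B) + colength A := by
  let f : B →ₗ[R] R := (LinearMap.mulLeft R x).comp B.subtype
  have hr : LinearMap.range f = Ideal.span {x} * B := by
    ext z
    rw [Ideal.mem_span_singleton_mul]
    constructor
    · rintro ⟨m, rfl⟩; exact ⟨m, m.2, rfl⟩
    · rintro ⟨m, hm, rfl⟩; exact ⟨⟨m, hm⟩, rfl⟩
  have hc : Submodule.comap f C = Submodule.comap B.subtype A := by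
    ext z
    exact h z z.2
  rw [colength_eq_add f (C := C) (B := C ⊔ Ideal.span {x} * B) (by rw [hr]), hc,
    colength_eq_add_of_le hAB]
  ring

theorem length_pi_quotient (ι : Type*) [Fintype ι] (I : Ideal R) :
    Module.length R ((ι → R) ⧸ Submodule.pi Set.univ fun _ : ι => I) =
      Fintype.card ι * colength I := by
  classical
  rw [(Submodule.quotientPi fun _ : ι => I).length_eq]
  simp [colength]

theorem colength_top : colength (⊤ : Ideal R) = 0 := by
  have : Subsingleton (R ⧸ (⊤ : Ideal R)) := Ideal.Quotient.subsingleton_iff.2 rfl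
  simp [colength]

end Colength

/-! ### Colengths of powers of the maximal ideal -/

section Local

variable {R : Type*} [CommRing R] [IsLocalRing R]

theorem colength_maximalIdeal : colength (maximalIdeal R) = 1 := by
  have : IsSimpleModule R (R ⧸ maximalIdeal R) := by
    rw [isSimpleModule_iff_isCoatom]
    exact (maximalIdeal.isMaximal R).out
  exact Module.length_eq_one R _

theorem colength_pow_succ [IsNoetherianRing R] (n : ℕ) :
    colength (maximalIdeal R ^ (n + 1)) =
      colength (maximalIdeal R ^ n) + numGens (maximalIdeal R ^ n) := by
  rw [colength_eq_add_of_le (Ideal.pow_le_pow_right n.le_succ)]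
  congr 1
  unfold numGens
  rw [IsLocalRing.spanFinrank_eq_finrank_quotient _ (IsNoetherian.noetherian _)]
  set N := maximalIdeal R ^ n
  have h : Submodule.comap N.subtype (maximalIdeal R ^ (n + 1)) =
      maximalIdeal R • (⊤ : Submodule R N) := by
    apply Submodule.map_injective_of_injective N.subtype_injective
    rw [Submodule.map_smul'', Submodule.map_comap_subtype, Submodule.map_top,
      Submodule.range_subtype, pow_succ', smul_eq_mul]
    exact inf_eq_right.2 Ideal.mul_le_right
  rw [h]
  let _ : Field (R ⧸ maximalIdeal R) := Ideal.Quotient.field _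
  rw [Module.length_eq_of_surjective (S := R) (R := R ⧸ maximalIdeal R)
    Ideal.Quotient.mk_surjective, Module.length_eq_finrank]

theorem colength_ne_top_of_pow_le [IsNoetherianRing R] {I : Ideal R} {n : ℕ}
    (h : maximalIdeal R ^ n ≤ I) : colength I ≠ ⊤ := by
  refine ne_top_of_le_ne_top ?_ (colength_anti h)
  clear h
  induction n with
  | zero => simp [colength_top]
  | succ n ih => rw [colength_pow_succ]; simp [ih]

end Local

/-! ### Quasi-regularity of two parameters -/

section Quasiregular

variable {R : Type*} [CommRing R]

theorem sup_pow_succ_le (A B : Ideal R) (n : ℕ) :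
    (A ⊔ B) ^ (n + 1) ≤ A * (A ⊔ B) ^ n ⊔ B ^ (n + 1) := by
  induction n with
  | zero => simp
  | succ n ih =>
    have hB : B ^ (n + 1) ≤ (A ⊔ B) ^ (n + 1) := Ideal.pow_right_mono le_sup_right _
    calc (A ⊔ B) ^ (n + 1 + 1) = (A ⊔ B) ^ (n + 1) * (A ⊔ B) := pow_succ _ _
      _ ≤ (A * (A ⊔ B) ^ n ⊔ B ^ (n + 1)) * (A ⊔ B) := Ideal.mul_mono_left ih
      _ = A * (A ⊔ B) ^ (n + 1) ⊔ (A * B ^ (n + 1) ⊔ B ^ (n + 1 + 1)) := by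
        rw [Ideal.sup_mul, mul_assoc, ← pow_succ, Ideal.mul_sup (B ^ (n + 1)), ← pow_succ,
          mul_comm A (B ^ (n + 1))]
      _ ≤ _ := sup_le le_sup_left
        (sup_le ((Ideal.mul_mono_right hB).trans le_sup_left) le_sup_right)

/-- `x` is a nonzerodivisor on `R` and `y` is a nonzerodivisor modulo `x`. -/
def IsRegularPair (x y : R) : Prop :=
  (∀ z, x * z = 0 → z = 0) ∧ ∀ s t, y * s = x * t → ∃ u, s = x * u

/-- All syzygies of `x` and `y ^ n` are multiples of the Koszul one. -/
def TrivialSyzygies (x y : R) : Prop :=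
  ∀ (n : ℕ) (a b : R), y ^ n * a = x * b → ∃ c, a = x * c ∧ b = y ^ n * c

/-- The class of (a, b) in R²/R(x, y) is killed by a power of 𝔪, and depth 2 leaves no such torsion.
This transfers regularity from x₀, y₀ to any 𝔪-primary pair. -/
theorem exists_mul_of_syzygy [IsLocalRing R] {x₀ y₀ x y : R} (h₀ : IsRegularPair x₀ y₀)
    (hx₀ : x₀ ∈ maximalIdeal R) (hy₀ : y₀ ∈ maximalIdeal R) {N : ℕ}
    (hN : maximalIdeal R ^ N ≤ Ideal.span {x, y}) {a b : R} (hab : y * a = x * b) :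
    ∃ c, a = x * c ∧ b = y * c := by
  have hann : ∀ c, x * c = 0 → y * c = 0 → c = 0 := by
    intro c hxc hyc
    have h1 : x₀ ^ N * c = 0 := by
      obtain ⟨p, q, hpq⟩ := Ideal.mem_span_pair.1 (hN (Ideal.pow_mem_pow hx₀ N))
      rw [← hpq]; linear_combination p * hxc + q * hyc
    clear hN hxc hyc
    induction N with
    | zero => simpa using h1
    | succ N ih => exact ih (h₀.1 _ (by rw [← h1]; ring))
  -- Descent on the power of 𝔪 carrying (a, b) into R(x, y): the multipliers s, r for x₀t and y₀t
  -- satisfy y₀s = x₀r, so regularity divides s by x₀. At k = N one may take t = 1.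
  have key : ∀ k ≤ N, ∀ t ∈ maximalIdeal R ^ (N - k), ∃ c, t * a = x * c ∧ t * b = y * c := by
    intro k
    induction k with
    | zero =>
      intro _ t ht
      obtain ⟨p, q, rfl⟩ := Ideal.mem_span_pair.1 (hN ht)
      exact ⟨p * a + q * b, by linear_combination q * hab, by linear_combination - p * hab⟩
    | succ k ih =>
      intro hk t ht
      have hstep : ∀ u ∈ maximalIdeal R, u * t ∈ maximalIdeal R ^ (N - k) := by
        intro u hu
        have : N - k = (N - (k + 1)) + 1 := by omega
        rw [this, pow_succ']
        exact Ideal.mul_mem_mul hu ht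
      obtain ⟨s, hs1, hs2⟩ := ih (by omega) _ (hstep x₀ hx₀)
      obtain ⟨r, hr1, hr2⟩ := ih (by omega) _ (hstep y₀ hy₀)
      have h1 : y₀ * s - x₀ * r = 0 := hann _
        (by linear_combination x₀ * hr1 - y₀ * hs1) (by linear_combination x₀ * hr2 - y₀ * hs2)
      obtain ⟨u, rfl⟩ := h₀.2 s r (sub_eq_zero.1 h1)
      exact ⟨u, sub_eq_zero.1 (h₀.1 _ (by linear_combination hs1)),
        sub_eq_zero.1 (h₀.1 _ (by linear_combination hs2))⟩
  simpa using key N le_rfl 1 (by simp)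

theorem IsRegularPair.trivialSyzygies [IsLocalRing R] {x₀ y₀ x y : R} (h₀ : IsRegularPair x₀ y₀)
    (hx₀ : x₀ ∈ maximalIdeal R) (hy₀ : y₀ ∈ maximalIdeal R) {N : ℕ}
    (hN : maximalIdeal R ^ N ≤ Ideal.span {x, y}) : TrivialSyzygies x y := by
  intro n a b hab
  have h1 : (Ideal.span {x, y} : Ideal R) ^ n ≤ Ideal.span {x, y ^ n} := by
    rw [Ideal.span_insert, Ideal.span_insert, ← Ideal.span_singleton_pow]
    cases n with
    | zero => simp
    | succ n => exact (sup_pow_succ_le _ _ n).trans (sup_le_sup_right Ideal.mul_le_left _)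
  refine exists_mul_of_syzygy h₀ hx₀ hy₀ (N := N * n) ?_ hab
  rw [pow_mul]
  exact (Ideal.pow_right_mono hN n).trans h1

/-- The value at `(x, y)` of the form of degree `n` with coefficients `c`. -/
def formEval (x y : R) (n : ℕ) (c : ℕ → R) : R :=
  ∑ i ∈ Finset.range (n + 1), c i * x ^ i * y ^ (n - i)

theorem mul_formEval_left (x y : R) (n : ℕ) (c : ℕ → R) :
    x * formEval x y n c = formEval x y (n + 1) (fun i => if i = 0 then 0 else c (i - 1)) := by
  unfold formEval
  rw [Finset.sum_range_succ' _ (n + 1), Finset.mul_sum]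
  simp only [Nat.add_sub_add_right, Nat.add_eq_zero_iff, one_ne_zero, and_false, if_false,
    Nat.add_sub_cancel, if_true, zero_mul, add_zero]
  exact Finset.sum_congr rfl fun i _ => by ring

theorem mul_formEval_right (x y : R) (n : ℕ) (c : ℕ → R) :
    y * formEval x y n c = formEval x y (n + 1) (fun i => if i ≤ n then c i else 0) := by
  unfold formEval
  rw [Finset.sum_range_succ _ (n + 1), Finset.mul_sum]
  simp only [Nat.not_succ_le_self, if_false, zero_mul, add_zero]
  refine Finset.sum_congr rfl fun i hi => ?_
  have hi : i ≤ n := by simpa [Nat.lt_succ_iff] using hi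
  rw [if_pos hi, Nat.succ_sub hi, pow_succ]
  ring

theorem formEval_add (x y : R) (n : ℕ) (c d : ℕ → R) :
    formEval x y n c + formEval x y n d = formEval x y n (fun i => c i + d i) := by
  simp [formEval, ← Finset.sum_add_distrib, add_mul]

theorem formEval_sub (x y : R) (n : ℕ) (c d : ℕ → R) :
    formEval x y n c - formEval x y n d = formEval x y n (fun i => c i - d i) := by
  simp [formEval, ← Finset.sum_sub_distrib, sub_mul]

theorem formEval_mul (x y : R) (n : ℕ) (c : ℕ → R) (w : R) :
    formEval x y n c * w = formEval x y n (fun i => c i * w) := by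
  simp only [formEval, Finset.sum_mul]
  exact Finset.sum_congr rfl fun i _ => by ring

theorem formEval_mem (x y : R) (n : ℕ) (c : ℕ → R) (I : Ideal R) (hc : ∀ i ≤ n, c i ∈ I) :
    formEval x y n c ∈ Ideal.span {x, y} ^ n * I := by
  refine Ideal.sum_mem _ fun i hi => ?_
  have hi : i ≤ n := by simpa [Nat.lt_succ_iff] using hi
  rw [mul_assoc, mul_comm (c i)]
  refine Ideal.mul_mem_mul ?_ (hc i hi)
  obtain ⟨j, rfl⟩ := Nat.exists_eq_add_of_le hi
  rw [Nat.add_sub_cancel_left, pow_add]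
  exact Ideal.mul_mem_mul (Ideal.pow_mem_pow (Ideal.subset_span (by simp)) _)
    (Ideal.pow_mem_pow (Ideal.subset_span (by simp)) _)

theorem exists_formEval_eq (x y : R) (n : ℕ) (I : Ideal R) {z : R}
    (hz : z ∈ Ideal.span {x, y} ^ n * I) : ∃ c : ℕ → R, (∀ i, c i ∈ I) ∧ z = formEval x y n c := by
  induction n generalizing z with
  | zero => exact ⟨fun _ => z, fun _ => by simpa using hz, by simp [formEval]⟩
  | succ n ih =>
    rw [pow_succ', mul_assoc, Ideal.span_insert, Ideal.sup_mul, Submodule.mem_sup] at hz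
    obtain ⟨u, hu, v, hv, rfl⟩ := hz
    obtain ⟨u, hu', rfl⟩ := Ideal.mem_span_singleton_mul.1 hu
    obtain ⟨v, hv', rfl⟩ := Ideal.mem_span_singleton_mul.1 hv
    rw [← Ideal.span_insert] at hu' hv'
    obtain ⟨a, ha, rfl⟩ := ih hu'
    obtain ⟨b, hb, rfl⟩ := ih hv'
    rw [mul_formEval_left, mul_formEval_right, formEval_add]
    refine ⟨_, fun i => ?_, rfl⟩
    split_ifs <;> simp [ha, hb, I.add_mem]

/-- The y^(n+1) coefficient is divisible by x; cancelling x leaves a relation one degree lower, with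
the Koszul correction absorbed in its y^n coefficient. -/
theorem TrivialSyzygies.mem_of_formEval_eq_zero {x y : R} (h : TrivialSyzygies x y) (n : ℕ)
    (c : ℕ → R) (hc : formEval x y n c = 0) : ∀ i ≤ n, c i ∈ Ideal.span {x, y} := by
  induction n generalizing c with
  | zero =>
    intro i hi
    obtain rfl : i = 0 := by omega
    have : c 0 = 0 := by simpa [formEval] using hc
    simp [this]
  | succ n ih =>
    have h1 : y ^ (n + 1) * c 0 = x * (- formEval x y n fun i => c (i + 1)) := by
      unfold formEval at hc ⊢
      rw [Finset.sum_range_succ'] at hc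
      rw [mul_neg, Finset.mul_sum, eq_neg_iff_add_eq_zero, ← hc, add_comm]
      congr 1
      · refine Finset.sum_congr rfl fun i _ => ?_
        rw [Nat.add_sub_add_right]; ring
      · simp [mul_comm]
    obtain ⟨d, hd1, hd2⟩ := h _ _ _ h1
    have h2 : formEval x y n (fun i => c (i + 1) + if i = 0 then y * d else 0) = 0 := by
      rw [← formEval_add, ← neg_neg (formEval x y n fun i => c (i + 1)), hd2]
      simp [formEval, ite_mul]
      ring
    intro i hi
    have hx : x ∈ Ideal.span {x, y} := Ideal.subset_span (by simp)
    have hy : y ∈ Ideal.span {x, y} := Ideal.subset_span (by simp)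
    cases i with
    | zero => rw [hd1]; exact Ideal.mul_mem_right _ _ hx
    | succ i =>
      have := ih _ h2 i (by omega)
      refine (Ideal.add_mem_iff_left _ ?_).1 this
      split_ifs
      · exact Ideal.mul_mem_right _ _ hy
      · simp

theorem TrivialSyzygies.mem_of_formEval_mem {x y : R} (h : TrivialSyzygies x y) {I : Ideal R}
    (hI : Ideal.span {x, y} ≤ I) (n : ℕ) (c : ℕ → R)
    (hc : formEval x y n c ∈ Ideal.span {x, y} ^ n * I) : ∀ i ≤ n, c i ∈ I := by
  intro i hi
  obtain ⟨d, hd, hcd⟩ := exists_formEval_eq x y n I hc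
  have := h.mem_of_formEval_eq_zero n (fun i => c i - d i) (by rw [← formEval_sub, hcd, sub_self])
    i hi
  simpa using I.add_mem (hI this) (hd i)

/-- Multiplying a form by x only shifts its coefficients. The power of J known to contain z is
raised one step at a time, so that z can be written as a form at all. -/
theorem TrivialSyzygies.mem_of_mul_mem {x y : R} (h : TrivialSyzygies x y) {I : Ideal R}
    (hI : Ideal.span {x, y} ≤ I) (n : ℕ) {z : R}
    (hz : x * z ∈ Ideal.span {x, y} ^ (n + 1) * I) : z ∈ Ideal.span {x, y} ^ n * I := by
  have key : ∀ k ≤ n, z ∈ Ideal.span {x, y} ^ k := by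
    intro k
    induction k with
    | zero => simp
    | succ k ih =>
      intro hk
      obtain ⟨c, -, rfl⟩ := exists_formEval_eq x y k ⊤ (by simpa using ih (by omega))
      rw [mul_formEval_left] at hz
      have h2 := h.mem_of_formEval_mem le_rfl (k + 1) _
        (by
          rw [← pow_succ]
          exact Ideal.pow_le_pow_right (by omega) (Ideal.mul_le_left hz))
      rw [pow_succ]
      exact formEval_mem _ _ _ _ _ fun i hi => by simpa using h2 (i + 1) (by omega)
  obtain ⟨c, -, rfl⟩ := exists_formEval_eq x y n ⊤ (by simpa using key n le_rfl)
  rw [mul_formEval_left] at hz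
  exact formEval_mem _ _ _ _ _ fun i hi => by
    simpa using h.mem_of_formEval_mem hI _ _ hz (i + 1) (by omega)

/-- `formEval` as a linear map in the coefficients, followed by multiplication by `w`. -/
def formEvalLin (x y : R) (n : ℕ) (w : R) : (Fin (n + 1) → R) →ₗ[R] R where
  toFun c := formEval x y n (fun i => if h : i < n + 1 then c ⟨i, h⟩ else 0) * w
  map_add' c d := by
    rw [← add_mul, formEval_add]
    congr 2; funext i; split_ifs <;> simp
  map_smul' a c := by
    rw [RingHom.id_apply, smul_eq_mul, ← mul_assoc, mul_comm a]
    congr 1; rw [formEval_mul]; congr 1; funext i; split_ifs <;> simp [mul_comm]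

/-- Quasi-regularity gives J^n/J^nI ≅ (R/I)^(n+1). -/
theorem TrivialSyzygies.colength_pow_mul {x y : R} (h : TrivialSyzygies x y) {I : Ideal R}
    (hI : Ideal.span {x, y} ≤ I) (n : ℕ) :
    colength (Ideal.span {x, y} ^ n * I) =
      colength (Ideal.span {x, y} ^ n) + (n + 1 : ℕ) * colength I := by
  rw [← Fintype.card_fin (n + 1), ← length_pi_quotient]
  have hr : LinearMap.range (formEvalLin x y n 1) = Ideal.span {x, y} ^ n := by
    ext z
    constructor
    · rintro ⟨c, rfl⟩
      have := formEval_mem x y n (fun i => if h : i < n + 1 then c ⟨i, h⟩ else 0) ⊤ (by simp)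
      simpa [formEvalLin] using this
    · intro hz
      obtain ⟨c, -, rfl⟩ := exists_formEval_eq x y n ⊤ (by simpa using hz)
      refine ⟨fun i => c i, ?_⟩
      simp only [formEvalLin, LinearMap.coe_mk, AddHom.coe_mk, mul_one]
      refine Finset.sum_congr rfl fun i hi => ?_
      simp only [dif_pos (Finset.mem_range.1 hi)]
  rw [colength_eq_add (formEvalLin x y n 1) (B := Ideal.span {x, y} ^ n)
    (by rw [hr]; exact sup_eq_right.2 Ideal.mul_le_left)]
  suffices hc : Submodule.comap (formEvalLin x y n 1) (Ideal.span {x, y} ^ n * I) =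
      Submodule.pi Set.univ fun _ => I by rw [hc]
  ext c
  simp only [Submodule.mem_comap, Submodule.mem_pi, Set.mem_univ, true_imp_iff]
  simp only [formEvalLin, LinearMap.coe_mk, AddHom.coe_mk, mul_one]
  constructor
  · intro hc i
    have := h.mem_of_formEval_mem hI n _ hc i (by omega)
    rwa [dif_pos i.2] at this
  · intro hc
    refine formEval_mem _ _ _ _ _ fun i hi => ?_
    rw [dif_pos (by omega)]
    exact hc _

theorem TrivialSyzygies.two_mul_colength_pow {x y : R} (h : TrivialSyzygies x y) (n : ℕ) :
    2 * colength (Ideal.span {x, y} ^ n) =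
      (n * (n + 1) : ℕ) * colength (Ideal.span {x, y}) := by
  induction n with
  | zero => simp [colength_top]
  | succ n ih =>
    rw [pow_succ, h.colength_pow_mul le_rfl, mul_add, ih]
    push_cast
    ring

end Quasiregular

/-! ### Hilbert function bounds from a two-generated reduction -/

section Reduction

variable {R : Type*} [CommRing R] [IsLocalRing R]

theorem pow_add_le_of_pow_succ_le {A : Type*} [CommRing A] {m J : Ideal A} {r : ℕ}
    (hr : m ^ (r + 1) ≤ J * m ^ r) (n : ℕ) : m ^ (n + r) ≤ J ^ n * m ^ r := by
  induction n with
  | zero => simp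
  | succ n ih =>
    calc m ^ (n + 1 + r) = m * m ^ (n + r) := by ring
      _ ≤ m * (J ^ n * m ^ r) := Ideal.mul_mono_right ih
      _ = J ^ n * m ^ (r + 1) := by ring
      _ ≤ J ^ n * (J * m ^ r) := Ideal.mul_mono_right hr
      _ = J ^ (n + 1) * m ^ r := by ring

/-- A unit coefficient forces w ∈ J, say w = ax + by. Modulo 𝔪 the product of the two forms then
vanishes, and a lowest-coefficient argument, as in the proof that k[X, Y] is a domain, gives a, b ∈
𝔪, against w ∉ J𝔪. -/
theorem TrivialSyzygies.mem_maximalIdeal_of_formEval_mul_mem {x y : R} (h : TrivialSyzygies x y)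
    (hJ : Ideal.span {x, y} ≤ maximalIdeal R) {w : R}
    (hw : w ∉ Ideal.span {x, y} * maximalIdeal R) (n : ℕ) (c : ℕ → R)
    (hc : formEval x y n c * w ∈ Ideal.span {x, y} ^ (n + 1) * maximalIdeal R) :
    ∀ i ≤ n, c i ∈ maximalIdeal R := by
  by_contra! hcon
  have hex : ∃ i, i ≤ n ∧ c i ∉ maximalIdeal R := hcon
  classical
  obtain ⟨hi, hci⟩ := Nat.find_spec hex
  set i := Nat.find hex with hi_def
  have hmin : ∀ j < i, c j ∈ maximalIdeal R := by
    intro j hj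
    by_contra hcj
    exact Nat.find_min hex hj ⟨by omega, hcj⟩
  have hu : IsUnit (c i) := by simpa using hci
  have hwJ : w ∈ Ideal.span {x, y} := by
    rw [formEval_mul] at hc
    have := h.mem_of_formEval_mem le_rfl n _ (by
      rw [← pow_succ]; exact Ideal.mul_le_left hc) i hi
    exact (Ideal.unit_mul_mem_iff_mem _ hu).1 this
  obtain ⟨a, b, rfl⟩ := Ideal.mem_span_pair.1 hwJ
  have hexp : formEval x y n c * (a * x + b * y) = formEval x y (n + 1)
      (fun j => (if j = 0 then 0 else c (j - 1)) * a + (if j ≤ n then c j else 0) * b) := by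
    rw [← formEval_add, ← formEval_mul, ← formEval_mul, ← mul_formEval_left, ← mul_formEval_right]
    ring
  rw [hexp] at hc
  have hcoef := h.mem_of_formEval_mem hJ (n + 1) _ hc
  have hb : b ∈ maximalIdeal R := by
    have h1 := hcoef i (by omega)
    simp only [if_pos hi] at h1
    refine (Ideal.unit_mul_mem_iff_mem _ hu).1 ((Ideal.add_mem_iff_right _ ?_).1 h1)
    split_ifs with h0
    · simp
    · exact Ideal.mul_mem_right _ _ (hmin _ (by omega))
  have ha : a ∈ maximalIdeal R := by
    have h1 := hcoef (i + 1) (by omega)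
    simp only [Nat.add_eq_zero_iff, one_ne_zero, and_false, if_false, Nat.add_sub_cancel] at h1
    exact (Ideal.unit_mul_mem_iff_mem _ hu).1
      ((Ideal.add_mem_iff_left _ (Ideal.mul_mem_left _ _ hb)).1 h1)
  apply hw
  rw [mul_comm]
  exact Ideal.add_mem _ (Ideal.mul_mem_mul ha (Ideal.subset_span (by simp)))
    (Ideal.mul_mem_mul hb (Ideal.subset_span (by simp)))

theorem TrivialSyzygies.colength_pow_add_le {x y : R} (h : TrivialSyzygies x y)
    (hJ : Ideal.span {x, y} ≤ maximalIdeal R) {w : R} (hw2 : w ∈ maximalIdeal R ^ 2)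
    (hw : w ∉ Ideal.span {x, y} * maximalIdeal R) (n : ℕ) :
    colength (maximalIdeal R ^ (n + 2)) + (n + 1 : ℕ) ≤
      colength (Ideal.span {x, y} ^ (n + 1) * maximalIdeal R) := by
  rw [colength_eq_add (formEvalLin x y n w)
    (C := Ideal.span {x, y} ^ (n + 1) * maximalIdeal R) rfl]
  refine add_le_add ?_ ?_
  · apply colength_anti
    refine sup_le ?_ ?_
    · rw [pow_succ (maximalIdeal R) (n + 1)]
      exact Ideal.mul_mono_left (Ideal.pow_right_mono hJ _)
    · rintro _ ⟨c, rfl⟩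
      rw [pow_add]
      refine Ideal.mul_mem_mul (Ideal.pow_right_mono hJ n ?_) hw2
      simpa using formEval_mem x y n (fun i => if h : i < n + 1 then c ⟨i, h⟩ else 0) ⊤ (by simp)
  · have hle : Submodule.comap (formEvalLin x y n w)
        (Ideal.span {x, y} ^ (n + 1) * maximalIdeal R) ≤
        Submodule.pi Set.univ fun _ => maximalIdeal R := by
      intro c hc i _
      have := h.mem_maximalIdeal_of_formEval_mul_mem hJ hw n _ hc i (by omega)
      rwa [dif_pos i.2] at this
    have := Module.length_le_of_surjective (Submodule.factor hle) (Submodule.factor_surjective hle)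
    rwa [length_pi_quotient, Fintype.card_fin, colength_maximalIdeal, mul_one] at this

variable [IsNoetherianRing R]

/-- The numerical consequences of the existence of a two-generated reduction: `H n` is the length
of `R / 𝔪 ^ n`. -/
structure HilbertBound (H : ℕ → ℕ) (e r : ℕ) : Prop where
  lower : ∀ n, n * (n + 1) * e ≤ 2 * H (n + r)
  upper : ∀ n, 2 * H n ≤ n * (n + 1) * e
  succ_le : ∀ n, H (n + 1) ≤ H n + n * e + 1
  eq_of_two : H 2 = H 1 + e + 1 → ∀ n, H (n + 1) = H n + n * e + 1
  eq_of_frequently : (∀ N, ∃ n ≥ N, H (n + 1) = H n + n * e + 1) →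
    ∀ n, H (n + 1) = H n + n * e + 1

theorem TrivialSyzygies.hilbertBound {x y : R} (h : TrivialSyzygies x y)
    (hJ : Ideal.span {x, y} ≤ maximalIdeal R) {r : ℕ}
    (hr : maximalIdeal R ^ (r + 1) ≤ Ideal.span {x, y} * maximalIdeal R ^ r) :
    HilbertBound (fun n => (colength (maximalIdeal R ^ n)).toNat)
      (colength (Ideal.span {x, y})).toNat r := by
  set m := maximalIdeal R with hm
  set J : Ideal R := Ideal.span {x, y} with hJdef
  have hLtop : ∀ n, colength (m ^ n) ≠ ⊤ := fun n => colength_ne_top_of_pow_le le_rfl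
  have hred : ∀ k, m ^ (r + k + 1) ≤ J * m ^ (r + k) := fun k => by
    rw [show r + k + 1 = r + 1 + k by ring, pow_add m (r + 1), pow_add m r k, ← mul_assoc]
    exact Ideal.mul_mono_left hr
  have hredpow : ∀ n, m ^ (n + r) ≤ J ^ n * m ^ r := pow_add_le_of_pow_succ_le hr
  have hpowle : ∀ n, J ^ n * m ≤ m ^ (n + 1) := fun n => by
    rw [pow_succ]; exact Ideal.mul_mono_left (Ideal.pow_right_mono hJ _)
  have hJtop : ∀ n, colength (J ^ n) ≠ ⊤ := fun n =>
    colength_ne_top_of_pow_le ((hredpow n).trans Ideal.mul_le_left)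
  have hBtop : ∀ n, colength (J ^ n * m) ≠ ⊤ := fun n => by
    refine colength_ne_top_of_pow_le (n := n + r + 1) ?_
    rw [pow_succ]
    exact Ideal.mul_mono_left ((hredpow n).trans Ideal.mul_le_left)
  obtain ⟨L, hL⟩ : ∃ L : ℕ → ℕ, ∀ n, colength (m ^ n) = L n :=
    ⟨_, fun n => (ENat.natCast_toNat (hLtop n)).symm⟩
  obtain ⟨a, ha⟩ : ∃ L : ℕ → ℕ, ∀ n, colength (J ^ n) = L n :=
    ⟨_, fun n => (ENat.natCast_toNat (hJtop n)).symm⟩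
  obtain ⟨b, hb⟩ : ∃ L : ℕ → ℕ, ∀ n, colength (J ^ n * m) = L n :=
    ⟨_, fun n => (ENat.natCast_toNat (hBtop n)).symm⟩
  obtain ⟨e, he⟩ : ∃ e : ℕ, colength J = e :=
    ⟨_, (ENat.natCast_toNat (by simpa using hJtop 1)).symm⟩
  simp only [hL, he, ENat.toNat_natCast]
  have haval : ∀ n, 2 * a n = n * (n + 1) * e := fun n => by
    have := h.two_mul_colength_pow n
    rw [ha, he] at this
    exact_mod_cast this
  have hbval : ∀ n, b n = a n + (n + 1) := fun n => by
    have := h.colength_pow_mul hJ n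
    rw [ha, hb, colength_maximalIdeal, mul_one] at this
    exact_mod_cast this
  have hbsucc : ∀ n, b (n + 1) = b n + (n + 1) * e + 1 := fun n => by
    have h1 := haval n
    have h2 := haval (n + 1)
    have h3 : (n + 1) * (n + 1 + 1) * e = n * (n + 1) * e + 2 * ((n + 1) * e) := by ring
    rw [hbval, hbval]
    omega
  have hL1 : L 1 = 1 := by
    have h1 := hL 1
    rw [pow_one, colength_maximalIdeal] at h1
    exact_mod_cast h1.symm
  have hL0 : L 0 = 0 := by
    have h1 := hL 0
    rw [pow_zero, Ideal.one_eq_top, colength_top] at h1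
    exact_mod_cast h1.symm
  -- The colength of this ideal is computable because J^(n+1)𝔪 : x = J^n𝔪. Equality in the bound on
  -- H(n+2) - H(n+1) means that the inclusion is an equality.
  have hDle : ∀ n, J ^ (n + 1) * m ⊔ Ideal.span {x} * m ^ (n + 1) ≤ m ^ (n + 2) := fun n => by
    refine sup_le (hpowle _) ?_
    rw [pow_succ' m (n + 1)]
    refine Ideal.mul_mono_left (le_trans ?_ hJ)
    exact Ideal.span_mono (by simp)
  have hD : ∀ n, colength (J ^ (n + 1) * m ⊔ Ideal.span {x} * m ^ (n + 1)) =
      (L (n + 1) + (n + 1) * e + 1 : ℕ) := fun n => by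
    have h1 := colength_mul_add (J ^ (n + 1) * m) (J ^ n * m) (m ^ (n + 1)) (hpowle n) x
      fun z _ => ⟨h.mem_of_mul_mem hJ n, fun hz => by
        rw [pow_succ', mul_assoc]
        exact Ideal.mul_mem_mul (Ideal.subset_span (by simp)) hz⟩
    rw [hb, hb, hL] at h1
    have hfin : colength (J ^ (n + 1) * m ⊔ Ideal.span {x} * m ^ (n + 1)) ≠ ⊤ :=
      ne_top_of_le_ne_top (hBtop _) (colength_anti le_sup_left)
    generalize colength (J ^ (n + 1) * m ⊔ Ideal.span {x} * m ^ (n + 1)) = t at *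
    lift t to ℕ using hfin
    have := hbsucc n
    norm_cast at h1 ⊢
    omega
  have hDeq : ∀ n, L (n + 2) = L (n + 1) + (n + 1) * e + 1 ↔
      J ^ (n + 1) * m ⊔ Ideal.span {x} * m ^ (n + 1) = m ^ (n + 2) := fun n => by
    constructor
    · intro h1
      refine eq_of_le_of_colength_le (hDle n) (by rw [hD]; exact ENat.natCast_ne_top _) ?_
      rw [hD, hL, h1]
    · intro h1
      have := hD n
      rw [h1, hL] at this
      exact_mod_cast this
  have hminimal : m ^ 2 ≤ J * m → ∀ n, L (n + 1) = L n + n * e + 1 := by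
    intro h2 n
    have hpow : ∀ n, L (n + 1) = b n := fun n => by
      have h3 : m ^ (n + 1) = J ^ n * m := by
        refine le_antisymm ?_ (hpowle n)
        induction n with
        | zero => simp
        | succ n ih =>
          calc m ^ (n + 1 + 1) = m ^ (n + 1) * m := pow_succ _ _
            _ ≤ J ^ n * m * m := Ideal.mul_mono_left ih
            _ = J ^ n * m ^ 2 := by ring
            _ ≤ J ^ n * (J * m) := Ideal.mul_mono_right h2
            _ = J ^ (n + 1) * m := by ring
      have h4 := hb n
      rw [← h3, hL] at h4
      exact_mod_cast h4
    cases n with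
    | zero => simp [hL0, hL1]
    | succ n => rw [hpow, hpow, hbsucc]
  refine ⟨fun n => ?_, fun n => ?_, fun n => ?_, fun h2 => hminimal ?_, fun hfreq => hminimal ?_⟩
  · rw [← haval]
    have := colength_anti ((hredpow n).trans Ideal.mul_le_left)
    rw [ha, hL] at this
    have : a n ≤ L (n + r) := by exact_mod_cast this
    omega
  · rw [← haval]
    have := colength_anti (Ideal.pow_right_mono hJ n)
    rw [ha, hL] at this
    have : L n ≤ a n := by exact_mod_cast this
    omega
  · cases n with
    | zero => simp [hL0, hL1]
    | succ n =>
      have := colength_anti (hDle n)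
      rw [hD, hL] at this
      exact_mod_cast this
  · have h3 : L 2 = b 1 := by
      have := haval 0
      rw [h2, hbsucc, hbval, hL1]
      omega
    have h4 : J ^ 1 * m = m ^ 2 := eq_of_le_of_colength_le (hpowle 1) (hBtop 1)
      (by rw [hb, hL, h3])
    rw [← h4, pow_one]
  · by_contra hcon
    obtain ⟨w, hw2, hw⟩ := SetLike.not_le_iff_exists.1 hcon
    have hlow : ∀ n, L (n + 2) + (n + 1) ≤ b (n + 1) := fun n => by
      have := h.colength_pow_add_le hJ hw2 hw n
      rw [hL, hb] at this
      exact_mod_cast this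
    obtain ⟨n₁, hn₁, heq⟩ := hfreq (r + 1)
    obtain ⟨k, rfl⟩ : ∃ k, n₁ = r + k + 1 := ⟨n₁ - (r + 1), by omega⟩
    -- Beyond r one has 𝔪^(s+1) ⊆ J𝔪^s; multiplying the equality of ideals by J passes it to the
    -- next exponent.
    have hall : ∀ j, L (r + k + j + 2) = L (r + k + j + 1) + (r + k + j + 1) * e + 1 := fun j => by
      rw [hDeq]
      induction j with
      | zero => exact (hDeq _).1 heq
      | succ j ih =>
        refine le_antisymm (hDle _) ?_
        have h1 := hred (k + j + 2)
        have h2 : m ^ (r + k + (j + 1) + 2) ≤ J * m ^ (r + k + j + 2) := by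
          convert h1 using 2 <;> ring_nf
        refine h2.trans ?_
        rw [← ih, Ideal.mul_sup]
        refine sup_le_sup ?_ ?_
        · rw [← mul_assoc, ← pow_succ']; exact le_rfl
        · calc J * (Ideal.span {x} * m ^ (r + k + j + 1))
              ≤ m * (Ideal.span {x} * m ^ (r + k + j + 1)) := Ideal.mul_mono_left hJ
            _ = Ideal.span {x} * m ^ (r + k + (j + 1) + 1) := by ring
    have hconst : ∀ j, b (r + k + j + 1) + L (r + k + 2) = L (r + k + j + 2) + b (r + k + 1) := by
      intro j
      induction j with
      | zero => simp [add_comm]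
      | succ j ih =>
        have h1 := hall (j + 1)
        have h2 := hbsucc (r + k + j + 1)
        simp only [← add_assoc] at h1
        rw [show r + k + j + 1 + 2 = r + k + j + 3 by ring,
          show r + k + j + 1 + 1 = r + k + j + 2 by ring] at *
        rw [show r + k + (j + 1) + 1 = r + k + j + 2 by ring,
          show r + k + (j + 1) + 2 = r + k + j + 3 by ring]
        omega
    -- The constant difference b(n) - L(n+1) is at most b(r+k+1), so shifting n by that amount
    -- already violates the lower bound `hlow`.
    have h1 := hconst (b (r + k + 1))
    have h2 := hlow (r + k + b (r + k + 1))
    omega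

end Reduction

/-! ### Two-generated reductions over an infinite residue field -/

section Existence

variable {R : Type*} [CommRing R]

theorem exists_sum_pow_ne_zero {k : Type*} [Field k] [Infinite k] {a : ℕ} (d : Fin a → k)
    (hd : d ≠ 0) : ∃ t, ∑ i, d i * t ^ (i : ℕ) ≠ 0 := by
  by_contra! h
  apply hd
  have hp : (∑ i : Fin a, Polynomial.monomial (i : ℕ) (d i)) = (0 : Polynomial k) :=
    Polynomial.funext fun t => by simp [Polynomial.eval_finsetSum, h]
  funext j
  have := congrArg (fun p => Polynomial.coeff p j) hp
  simpa [Polynomial.finsetSum_coeff, Polynomial.coeff_monomial, Fin.val_inj] using this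

theorem exists_isUnit_sum_pow [IsLocalRing R] [Infinite (ResidueField R)] {a : ℕ}
    (c : Fin a × Fin a → R) (hc : ∃ i, c i ∉ maximalIdeal R) :
    ∃ α β, IsUnit (∑ i, c i * (α ^ (i.1 : ℕ) * β ^ (i.2 : ℕ))) := by
  obtain ⟨⟨i₀, j₀⟩, h₀⟩ := hc
  obtain ⟨t, ht⟩ := exists_sum_pow_ne_zero (fun j => residue R (c (i₀, j))) fun h =>
    h₀ ((residue_eq_zero_iff _).1 (congrFun h j₀))
  obtain ⟨s, hs⟩ := exists_sum_pow_ne_zero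
    (fun i => ∑ j, residue R (c (i, j)) * t ^ (j : ℕ)) fun h => ht (congrFun h i₀)
  obtain ⟨β, rfl⟩ := residue_surjective t
  obtain ⟨α, rfl⟩ := residue_surjective s
  refine ⟨α, β, ?_⟩
  rw [← residue_ne_zero_iff_isUnit]
  convert hs using 1
  rw [map_sum, Fintype.sum_prod_type]
  refine Finset.sum_congr rfl fun i _ => ?_
  rw [Finset.sum_mul]
  refine Finset.sum_congr rfl fun j _ => ?_
  simp only [map_mul, map_pow]
  ring

/-- `u` and `v` lie in `J ^ n` and are congruent modulo `J' * J ^ (n - 1)`. -/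
structure PowCongr (J' J : Ideal R) (n : ℕ) (u v : R) : Prop where
  left : u ∈ J ^ n
  right : v ∈ J ^ n
  sub : u - v ∈ J' * J ^ (n - 1)

theorem PowCongr.mul {J' J : Ideal R} {n n' : ℕ} {u v u' v' : R} (h : PowCongr J' J n u v)
    (h' : PowCongr J' J n' u' v') : PowCongr J' J (n + n') (u * u') (v * v') where
  left := by rw [pow_add]; exact Ideal.mul_mem_mul h.left h'.left
  right := by rw [pow_add]; exact Ideal.mul_mem_mul h.right h'.right
  sub := by
    have e : u * u' - v * v' = (u - v) * u' + (u' - v') * v := by ring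
    rw [e]
    refine Ideal.add_mem _ ?_ ?_
    · have := Ideal.mul_mem_mul h.sub h'.left
      rw [mul_assoc, ← pow_add] at this
      exact Ideal.mul_mono_right (Ideal.pow_le_pow_right (by omega)) this
    · have := Ideal.mul_mem_mul h'.sub h.right
      rw [mul_assoc, ← pow_add] at this
      exact Ideal.mul_mono_right (Ideal.pow_le_pow_right (by omega)) this

theorem PowCongr.pow {J' J : Ideal R} {u v : R} (h : PowCongr J' J 1 u v) (n : ℕ) :
    PowCongr J' J n (u ^ n) (v ^ n) := by
  induction n with
  | zero => exact ⟨by simp, by simp, by simp⟩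
  | succ n ih => rw [pow_succ, pow_succ]; exact ih.mul h

/-- The form `∑ c i j * x ^ i * y ^ j * z ^ (2 * a - i - j)` as a linear map in `c`. -/
def ternaryForm (x y z : R) (a : ℕ) : (Fin a × Fin a → R) →ₗ[R] R :=
  Fintype.linearCombination R fun i : Fin a × Fin a =>
    x ^ (i.1 : ℕ) * y ^ (i.2 : ℕ) * z ^ (2 * a - i.1 - i.2)

/-- Modulo J' one may replace x by αz and y by βz, which leaves the value of the form at (α, β, 1)
times z^(2a). -/
theorem ternaryForm_sub_mem {K : Ideal R} {x y z α β : R} {a : ℕ} (c : Fin a × Fin a → R) :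
    ternaryForm x y z a c - (∑ i, c i * (α ^ (i.1 : ℕ) * β ^ (i.2 : ℕ))) * z ^ (2 * a) ∈
      (K ⊔ Ideal.span {x - α * z, y - β * z}) *
        (K ⊔ Ideal.span {x - α * z, y - β * z} ⊔ Ideal.span {z}) ^ (2 * a - 1) := by
  set J' := K ⊔ Ideal.span {x - α * z, y - β * z}
  set J := J' ⊔ Ideal.span {z}
  have hz : z ∈ J := Ideal.mem_sup_right (Ideal.mem_span_singleton_self z)
  have hx' : x - α * z ∈ J' := Ideal.mem_sup_right (Ideal.subset_span (by simp))
  have hy' : y - β * z ∈ J' := Ideal.mem_sup_right (Ideal.subset_span (by simp))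
  have hcong : ∀ {u t : R}, u - t * z ∈ J' → PowCongr J' J 1 u (t * z) := fun {u t} h =>
    ⟨by
      rw [pow_one]
      simpa using J.add_mem (Ideal.mem_sup_left h : u - t * z ∈ J) (J.mul_mem_left t hz),
      by rw [pow_one]; exact J.mul_mem_left t hz, by simpa using h⟩
  have hzz : PowCongr J' J 1 z z := ⟨by simpa, by simpa, by simp⟩
  rw [ternaryForm, Fintype.linearCombination_apply, Finset.sum_mul, ← Finset.sum_sub_distrib]
  refine Ideal.sum_mem _ fun i _ => ?_
  have h := (((hcong hx').pow i.1).mul ((hcong hy').pow i.2)).mul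
    (hzz.pow (2 * a - i.1 - i.2))
  have hn : (i.1 + i.2 + (2 * a - i.1 - i.2) : ℕ) = 2 * a := by omega
  have hs := h.sub
  rw [hn] at hs
  convert Ideal.mul_mem_left _ (c i) hs using 1
  have hzpow : z ^ (2 * a) = z ^ (i.1 : ℕ) * z ^ (i.2 : ℕ) * z ^ (2 * a - i.1 - i.2) := by
    rw [← pow_add, ← pow_add, hn]
  rw [hzpow, smul_eq_mul, mul_pow, mul_pow]
  ring

variable [IsLocalRing R]

theorem colength_add_le_of_ternaryForm {x y z : R} (hx : x ∈ maximalIdeal R)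
    (hy : y ∈ maximalIdeal R) (hz : z ∈ maximalIdeal R) {a : ℕ}
    (h : ∀ c : Fin a × Fin a → R, ternaryForm x y z a c ∈ maximalIdeal R ^ (2 * a + 1) →
      ∀ i, c i ∈ maximalIdeal R) :
    colength (maximalIdeal R ^ (2 * a)) + (a ^ 2 : ℕ) ≤
      colength (maximalIdeal R ^ (2 * a + 1)) := by
  rw [colength_eq_add (ternaryForm x y z a) (C := maximalIdeal R ^ (2 * a + 1)) rfl]
  refine add_le_add (colength_anti (sup_le (Ideal.pow_le_pow_right (by omega)) ?_)) ?_
  · rintro _ ⟨c, rfl⟩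
    rw [ternaryForm, Fintype.linearCombination_apply]
    refine Ideal.sum_mem _ fun i _ => Ideal.mul_mem_left _ _ ?_
    have hn : 2 * a = (i.1 + i.2 + (2 * a - i.1 - i.2) : ℕ) := by omega
    have := Ideal.mul_mem_mul (Ideal.mul_mem_mul (Ideal.pow_mem_pow hx i.1)
      (Ideal.pow_mem_pow hy i.2)) (Ideal.pow_mem_pow hz (2 * a - i.1 - i.2))
    rwa [← pow_add, ← pow_add, ← hn] at this
  · have hle : Submodule.comap (ternaryForm x y z a) (maximalIdeal R ^ (2 * a + 1)) ≤
        Submodule.pi Set.univ fun _ => maximalIdeal R := fun c hc i _ => h c hc i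
    have := Module.length_le_of_surjective (Submodule.factor hle) (Submodule.factor_surjective hle)
    rw [length_pi_quotient, colength_maximalIdeal, mul_one] at this
    simpa [sq] using this

variable [IsNoetherianRing R]

/-- As in Noether normalization, a generic substitution makes the coefficient of z^(2a) a unit. Up
to 𝔪^(2a+1), z is then integral over the remaining generators, and Nakayama removes the error term.
-/
theorem exists_reduction_of_ternaryForm_mem [Infinite (ResidueField R)] {K : Ideal R} {x y z : R}
    (hK : K ≤ maximalIdeal R) (hx : x ∈ maximalIdeal R) (hy : y ∈ maximalIdeal R)
    (hz : z ∈ maximalIdeal R) {r : ℕ} (hr : maximalIdeal R ^ (r + 1) ≤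
      (K ⊔ Ideal.span {x, y} ⊔ Ideal.span {z}) * maximalIdeal R ^ r)
    {a : ℕ} (c : Fin a × Fin a → R) (hc : ∃ i, c i ∉ maximalIdeal R)
    (hmem : ternaryForm x y z a c ∈ maximalIdeal R ^ (2 * a + 1)) :
    ∃ x' ∈ maximalIdeal R, ∃ y' ∈ maximalIdeal R, ∃ r', maximalIdeal R ^ (r' + 1) ≤
      (K ⊔ Ideal.span {x', y'}) * maximalIdeal R ^ r' := by
  obtain ⟨α, β, hu⟩ := exists_isUnit_sum_pow c hc
  have ha : 0 < a := by obtain ⟨i, -⟩ := hc; exact i.1.pos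
  obtain ⟨n, hn⟩ : ∃ n, 2 * a = n + 1 := ⟨2 * a - 1, by omega⟩
  have hsub := ternaryForm_sub_mem (K := K) (x := x) (y := y) (z := z) (α := α) (β := β) c
  set u := ∑ i, c i * (α ^ (i.1 : ℕ) * β ^ (i.2 : ℕ))
  have hx' : x - α * z ∈ maximalIdeal R := Ideal.sub_mem _ hx (Ideal.mul_mem_left _ _ hz)
  have hy' : y - β * z ∈ maximalIdeal R := Ideal.sub_mem _ hy (Ideal.mul_mem_left _ _ hz)
  refine ⟨_, hx', _, hy', n + r, ?_⟩
  set m := maximalIdeal R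
  set J' := K ⊔ Ideal.span {x - α * z, y - β * z}
  set J := J' ⊔ Ideal.span {z} with hJ
  have hJ'm : J' ≤ m := sup_le hK (Ideal.span_le.2 (by
    rintro _ (rfl | rfl) <;> assumption))
  have hJm : J ≤ m := sup_le hJ'm (by rwa [Ideal.span_singleton_le_iff_mem])
  have hzJ : z ∈ J := Ideal.mem_sup_right (Ideal.mem_span_singleton_self z)
  have hold : K ⊔ Ideal.span {x, y} ⊔ Ideal.span {z} ≤ J := by
    refine sup_le (sup_le (le_sup_left.trans le_sup_left) (Ideal.span_le.2 ?_)) le_sup_right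
    have h1 : x - α * z ∈ J :=
      Ideal.mem_sup_left (Ideal.mem_sup_right (Ideal.subset_span (by simp)))
    have h2 : y - β * z ∈ J :=
      Ideal.mem_sup_left (Ideal.mem_sup_right (Ideal.subset_span (by simp)))
    rintro _ (rfl | rfl)
    · simpa using J.add_mem h1 (J.mul_mem_left α hzJ)
    · simpa using J.add_mem h2 (J.mul_mem_left β hzJ)
  rw [hn, Nat.add_sub_cancel] at hsub
  rw [hn] at hmem
  have hzpow : z ^ (n + 1) ∈ J' * J ^ n ⊔ m ^ (n + 2) := by
    rw [← Ideal.unit_mul_mem_iff_mem _ hu]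
    have := Ideal.sub_mem _ (Ideal.mem_sup_right hmem) (Ideal.mem_sup_left hsub)
    simpa using this
  have hJpow : J ^ (n + 1) ≤ J' * J ^ n ⊔ m ^ (n + 2) := by
    refine (sup_pow_succ_le J' (Ideal.span {z}) n).trans (sup_le le_sup_left ?_)
    rwa [Ideal.span_singleton_pow, Ideal.span_singleton_le_iff_mem]
  refine Submodule.le_of_le_smul_of_le_jacobson_bot (I := m) (IsNoetherian.noetherian _)
    (IsLocalRing.maximalIdeal_le_jacobson _) ?_
  have hred : m ^ (r + 1) ≤ J * m ^ r := hr.trans (Ideal.mul_mono_left hold)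
  calc m ^ (n + r + 1) = m ^ (n + 1 + r) := by ring
    _ ≤ J ^ (n + 1) * m ^ r := pow_add_le_of_pow_succ_le hred _
    _ ≤ (J' * J ^ n ⊔ m ^ (n + 2)) * m ^ r := Ideal.mul_mono_left hJpow
    _ = J' * (J ^ n * m ^ r) ⊔ m * m ^ (n + r + 1) := by rw [Ideal.sup_mul]; ring_nf
    _ ≤ J' * (m ^ n * m ^ r) ⊔ m * m ^ (n + r + 1) := sup_le_sup_right
      (Ideal.mul_mono_right (Ideal.mul_mono_left (Ideal.pow_right_mono hJm n))) _
    _ = _ := by rw [← pow_add]; rfl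

/-- If no form with a unit coefficient fell into 𝔪^(2a+1), the a² monomials of degree 2a would be
independent for every a, and the colengths would grow cubically. -/
theorem exists_reduction_drop [Infinite (ResidueField R)] {C : ℕ}
    (hC : ∀ n : ℕ, 2 * colength (maximalIdeal R ^ n) ≤ (n * (n + 1) * C : ℕ))
    {K : Ideal R} {x y z : R}
    (hK : K ≤ maximalIdeal R) (hx : x ∈ maximalIdeal R) (hy : y ∈ maximalIdeal R)
    (hz : z ∈ maximalIdeal R) {r : ℕ} (hr : maximalIdeal R ^ (r + 1) ≤
      (K ⊔ Ideal.span {x, y} ⊔ Ideal.span {z}) * maximalIdeal R ^ r) :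
    ∃ x' ∈ maximalIdeal R, ∃ y' ∈ maximalIdeal R, ∃ r', maximalIdeal R ^ (r' + 1) ≤
      (K ⊔ Ideal.span {x', y'}) * maximalIdeal R ^ r' := by
  by_cases h : ∃ (a : ℕ) (c : Fin a × Fin a → R), (∃ i, c i ∉ maximalIdeal R) ∧
      ternaryForm x y z a c ∈ maximalIdeal R ^ (2 * a + 1)
  · obtain ⟨a, c, hc, hmem⟩ := h
    exact exists_reduction_of_ternaryForm_mem hK hx hy hz hr c hc hmem
  exfalso
  push Not at h
  obtain ⟨L, hL⟩ : ∃ L : ℕ → ℕ, ∀ n, colength (maximalIdeal R ^ n) = L n :=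
    ⟨_, fun n => (ENat.natCast_toNat (colength_ne_top_of_pow_le le_rfl)).symm⟩
  have h1 : ∀ a, L (2 * a) + a ^ 2 ≤ L (2 * a + 2) := fun a => by
    have h2 := (colength_add_le_of_ternaryForm hx hy hz (a := a) fun c hc i => by
      by_contra hci
      exact h a c ⟨i, hci⟩ hc).trans (colength_anti (Ideal.pow_le_pow_right (Nat.le_succ _)))
    rw [hL, hL] at h2
    exact_mod_cast h2
  have h2 : ∀ n, n ^ 3 ≤ 3 * L (2 * n) + 3 * n ^ 2 := fun n => by
    induction n with
    | zero => simp
    | succ n ih =>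
      have := h1 n
      rw [show 2 * (n + 1) = 2 * n + 2 by ring]
      nlinarith
  have h3 : ∀ n, 2 * L n ≤ n * (n + 1) * C := fun n => by
    have := hC n
    rw [hL] at this
    exact_mod_cast this
  -- For n ≥ 1 the bounds `h2` and `h3` give n² ≤ 3(2n+1)C + 3n ≤ n(9C + 3), which fails at n = 9C +
  -- 4.
  have h4 := h2 (9 * C + 4)
  have h5 := h3 (2 * (9 * C + 4))
  nlinarith

theorem exists_reduction [Infinite (ResidueField R)] {C : ℕ}
    (hC : ∀ n : ℕ, 2 * colength (maximalIdeal R ^ n) ≤ (n * (n + 1) * C : ℕ)) :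
    ∃ x ∈ maximalIdeal R, ∃ y ∈ maximalIdeal R, ∃ r, maximalIdeal R ^ (r + 1) ≤
      Ideal.span {x, y} * maximalIdeal R ^ r := by
  classical
  have key : ∀ t : Finset R, (t : Set R) ⊆ maximalIdeal R → ∀ x ∈ maximalIdeal R,
      ∀ y ∈ maximalIdeal R, ∀ r, maximalIdeal R ^ (r + 1) ≤
        (Ideal.span t ⊔ Ideal.span {x, y}) * maximalIdeal R ^ r →
      ∃ x ∈ maximalIdeal R, ∃ y ∈ maximalIdeal R, ∃ r, maximalIdeal R ^ (r + 1) ≤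
        Ideal.span {x, y} * maximalIdeal R ^ r := by
    intro t
    induction t using Finset.induction_on with
    | empty =>
      intro _ x hx y hy r hr
      exact ⟨x, hx, y, hy, r, by simpa using hr⟩
    | insert z t _ ih =>
      intro ht x hx y hy r hr
      rw [Finset.coe_insert, Set.insert_subset_iff] at ht
      have hr' : maximalIdeal R ^ (r + 1) ≤ (Ideal.span (t : Set R) ⊔ Ideal.span {x, y} ⊔
          Ideal.span {z}) * maximalIdeal R ^ r := by
        rwa [Finset.coe_insert, Ideal.span_insert, sup_assoc, sup_comm (Ideal.span {z})] at hr
      obtain ⟨x', hx', y', hy', r', hr''⟩ :=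
        exists_reduction_drop hC (Ideal.span_le.2 ht.2) hx hy ht.1 hr'
      exact ih ht.2 x' hx' y' hy' r' hr''
  obtain ⟨t, ht⟩ := (IsNoetherian.noetherian (maximalIdeal R) : (maximalIdeal R).FG)
  -- The induction starts with all generators of 𝔪 in t and the pair (0, 0), where the reduction
  -- number is 0.
  refine key t (by rw [← ht]; exact Ideal.subset_span) 0 (zero_mem _) 0 (zero_mem _) 0 ?_
  have ht' : Ideal.span (t : Set R) = maximalIdeal R := ht
  simp [ht']

theorem IsRegularPair.exists_hilbertBound [Infinite (ResidueField R)] {x₀ y₀ : R}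
    (h : IsRegularPair x₀ y₀) (hx₀ : x₀ ∈ maximalIdeal R) (hy₀ : y₀ ∈ maximalIdeal R) {N : ℕ}
    (hN : maximalIdeal R ^ N ≤ Ideal.span {x₀, y₀}) :
    ∃ e r, HilbertBound (fun n => (colength (maximalIdeal R ^ n)).toNat) e r := by
  have hJ₀ : Ideal.span {x₀, y₀} ≤ maximalIdeal R := Ideal.span_le.2 (by
    rintro _ (rfl | rfl) <;> assumption)
  obtain ⟨C, hC⟩ : ∃ C : ℕ, colength (Ideal.span {x₀, y₀}) = C :=
    ⟨_, (ENat.natCast_toNat (colength_ne_top_of_pow_le hN)).symm⟩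
  obtain ⟨x, hx, y, hy, r, hr⟩ := exists_reduction (R := R) (C := C) fun n => by
    have := (h.trivialSyzygies hx₀ hy₀ hN).two_mul_colength_pow n
    rw [Nat.cast_mul, ← hC, ← this]
    gcongr
    exact colength_anti (Ideal.pow_right_mono hJ₀ n)
  exact ⟨_, r, (h.trivialSyzygies hx₀ hy₀ (hr.trans Ideal.mul_le_left)).hilbertBound
    (Ideal.span_le.2 (by rintro _ (rfl | rfl) <;> assumption)) hr⟩

end Existence

/-! ### Passage to R(X) -/

section BaseChange

open TensorProduct

/-- Flat local base change multiplies lengths by ℓ(S/𝔪S), which is 1 here. -/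
theorem colength_map {R S : Type*} [CommRing R] [CommRing S] [IsLocalRing R] [IsLocalRing S]
    [Algebra R S] [Module.Flat R S]
    (h : (maximalIdeal R).map (algebraMap R S) = maximalIdeal S) (I : Ideal R) :
    colength (I.map (algebraMap R S)) = colength I := by
  have : IsLocalHom (algebraMap R S) := ((local_hom_TFAE (algebraMap R S)).out 0 2 rfl rfl).2 h.le
  have h1 := length_baseChange R S (R ⧸ I)
  have h2 : Module.length S (S ⧸ maximalIdeal S) = 1 := colength_maximalIdeal
  rw [h, h2, mul_one] at h1
  unfold colength
  rw [← h1]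
  exact (Algebra.TensorProduct.quotIdealMapEquivTensorQuot S I).toLinearEquiv.length_eq

theorem isRegularPair_of_isWeaklyRegular {R : Type*} [CommRing R] {x y : R}
    (h : RingTheory.Sequence.IsWeaklyRegular R [x, y]) : IsRegularPair x y := by
  constructor
  · intro z hz
    have h1 := ((RingTheory.Sequence.isWeaklyRegular_cons_iff R x [y]).1 h).1
    exact h1 (by simpa using hz)
  · intro s t hst
    have h1 := h.regular_mod_prev 1 (by simp)
    have h2 : (Submodule.Quotient.mk s : R ⧸ (Ideal.ofList ([x, y].take 1) • (⊤ : Ideal R))) = 0 := by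
      apply h1
      dsimp only
      rw [smul_zero, ← Submodule.Quotient.mk_smul, Submodule.Quotient.mk_eq_zero]
      simpa [hst] using Ideal.mul_mem_right t _ (Ideal.mem_span_singleton_self x)
    rw [Submodule.Quotient.mk_eq_zero] at h2
    simpa [Ideal.mem_span_singleton, Dvd.dvd] using h2

variable (R : Type*) [CommRing R] [IsLocalRing R]

open Polynomial in
/-- The localization `R(X)` of `R[X]` at the extension of the maximal ideal of `R`. -/
abbrev NagataRing : Type _ := Localization.AtPrime ((maximalIdeal R).map (C : R →+* R[X]))

theorem map_maximalIdeal_nagataRing :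
    (maximalIdeal R).map (algebraMap R (NagataRing R)) = maximalIdeal (NagataRing R) := by
  rw [← Localization.AtPrime.map_eq_maximalIdeal, Ideal.map_map]
  congr 1

open Polynomial in
instance infinite_residueField_nagataRing : Infinite (ResidueField (NagataRing R)) := by
  refine Infinite.of_injective
    (fun n : ℕ => residue (NagataRing R) (algebraMap R[X] (NagataRing R) (X ^ n))) fun i j hij => ?_
  by_contra hne
  dsimp only at hij
  rw [← sub_eq_zero, ← map_sub, ← map_sub, residue_eq_zero_iff,
    IsLocalization.AtPrime.to_map_mem_maximal_iff _ ((maximalIdeal R).map (C : R →+* R[X])),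
    Ideal.mem_map_C_iff] at hij
  have := hij i
  rw [coeff_sub, coeff_X_pow_self, coeff_X_pow, if_neg hne, sub_zero] at this
  exact (Ideal.ne_top_iff_one _).1 (maximalIdeal.isMaximal R).ne_top this

instance flat_nagataRing : Module.Flat R (NagataRing R) :=
  Module.Flat.trans R (Polynomial R) _

variable {R}

theorem exists_hilbertBound [IsNoetherianRing R] {x y : R}
    (h : RingTheory.Sequence.IsWeaklyRegular R [x, y]) (hx : x ∈ maximalIdeal R)
    (hy : y ∈ maximalIdeal R) {N : ℕ} (hN : maximalIdeal R ^ N ≤ Ideal.span {x, y}) :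
    ∃ e r, HilbertBound (fun n => (colength (maximalIdeal R ^ n)).toNat) e r := by
  have hmap := map_maximalIdeal_nagataRing R
  have hreg := isRegularPair_of_isWeaklyRegular (h.of_flat (S := NagataRing R))
  have key := hreg.exists_hilbertBound (hmap ▸ Ideal.mem_map_of_mem _ hx)
    (hmap ▸ Ideal.mem_map_of_mem _ hy) (N := N) (by
      rw [← hmap, ← Ideal.map_pow]
      refine (Ideal.map_mono hN).trans_eq ?_
      rw [Ideal.map_span, Set.image_pair])
  simpa only [← hmap, ← Ideal.map_pow, colength_map hmap] using key

end BaseChange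

/-! ### Multiplicity, Loewy length and the equivalence -/

section Main

variable {R : Type*} [CommRing R] [IsLocalRing R]

theorem exists_weaklyRegular_pair [IsNoetherianRing R] (hCM : IsCohenMacaulay R)
    (hdim : ringKrullDim R = 2) : ∃ x ∈ maximalIdeal R, ∃ y ∈ maximalIdeal R,
      RingTheory.Sequence.IsWeaklyRegular R [x, y] ∧
        ∃ N, maximalIdeal R ^ N ≤ Ideal.span {x, y} := by
  obtain ⟨rs, hmem, hreg, hlen⟩ := hCM
  rw [hdim] at hlen
  have hlen' : rs.length = 2 := by exact_mod_cast hlen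
  obtain ⟨x, y, rfl⟩ := List.length_eq_two.1 hlen'
  refine ⟨x, hmem x (by simp), y, hmem y (by simp), hreg.toIsWeaklyRegular, ?_⟩
  have h1 := ringKrullDim_add_length_eq_ringKrullDim_of_isRegular _ hreg
  have hJ : Ideal.ofList [x, y] = Ideal.span {x, y} := by
    simp [Ideal.ofList_cons, Ideal.span_insert]
  rw [hJ, hdim, hlen'] at h1
  have h0 : ringKrullDim (R ⧸ Ideal.span {x, y}) ≤ 0 := by
    generalize ringKrullDim (R ⧸ Ideal.span {x, y}) = t at h1 ⊢
    cases t with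
    | bot => exact bot_le
    | coe t =>
      have h2 : t + 2 = 2 := WithBot.coe_injective h1
      have h3 : t = 0 := ENat.add_left_injective_of_ne_top (ENat.natCast_ne_top 2)
        (h2.trans (zero_add _).symm)
      rw [h3]
      exact le_rfl
  have hmin := Ideal.krullDimLE_zero_quotient_iff_forall_minimalPrimes_isMaximal.1
    ((Order.krullDimLE_iff _ _).2 h0 : Ring.KrullDimLE 0 (R ⧸ Ideal.span {x, y}))
  refine Ideal.exists_pow_le_of_le_radical_of_fg ?_ (IsNoetherian.noetherian _)
  rw [← Ideal.sInf_minimalPrimes]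
  exact le_sInf fun P hP => (eq_maximalIdeal (hmin P hP)).ge

/-- Otherwise 𝔪^k = 𝔪·𝔪^k, so 𝔪^k = 0 by Nakayama, although x^k ≠ 0 for a nonzerodivisor x. -/
theorem IsRegularPair.not_pow_le [IsNoetherianRing R] {x y : R} (h : IsRegularPair x y)
    (hx : x ∈ maximalIdeal R) {k n : ℕ} (hkn : k < n) :
    ¬ maximalIdeal R ^ k ≤ maximalIdeal R ^ n := by
  intro hle
  have h1 : maximalIdeal R ^ k = ⊥ := by
    refine Submodule.eq_bot_of_le_smul_of_le_jacobson_bot (maximalIdeal R) _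
      (IsNoetherian.noetherian _) ?_ (maximalIdeal_le_jacobson _)
    rw [smul_eq_mul, ← pow_succ']
    exact hle.trans (Ideal.pow_le_pow_right hkn)
  have h2 : x ^ k * 1 = 0 := by
    have := Ideal.pow_mem_pow hx k
    rw [h1] at this
    simpa using this
  clear h1 hkn hle
  induction k with
  | zero => simp at h2
  | succ k ih => exact ih (h.1 _ (by rw [← h2]; ring))

theorem IsRegularPair.loewyLength_pow [IsNoetherianRing R] {x y : R} (h : IsRegularPair x y)
    (hx : x ∈ maximalIdeal R) (n : ℕ) : loewyLength (maximalIdeal R ^ n) = n := by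
  have hn : n ∈ {k | maximalIdeal R ^ k ≤ maximalIdeal R ^ n} := le_refl (maximalIdeal R ^ n)
  refine le_antisymm (Nat.sInf_le hn) (le_csInf ⟨n, hn⟩ fun k hk => ?_)
  by_contra hkn
  exact h.not_pow_le hx (not_le.1 hkn) hk

theorem HilbertBound.tendsto {H : ℕ → ℕ} {e r : ℕ} (h : HilbertBound H e r) :
    Tendsto (fun n : ℕ => 2 * (H n : ℝ) / (n : ℝ) ^ 2) atTop (nhds (e : ℝ)) := by
  have hlow : ∀ n : ℕ, (n : ℝ) ^ 2 * e - n * (2 * r * e) ≤ 2 * H n := fun n => by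
    rcases le_total r n with hrn | hrn
    · obtain ⟨k, rfl⟩ := Nat.exists_eq_add_of_le' hrn
      have h1 : ((k * (k + 1) * e : ℕ) : ℝ) ≤ (2 * H (k + r) : ℕ) := by exact_mod_cast h.lower k
      push_cast at h1 ⊢
      have : (0 : ℝ) ≤ k * e + r ^ 2 * e := by positivity
      nlinarith
    · have h1 : (n : ℝ) ≤ r := by exact_mod_cast hrn
      have h2 : (n : ℝ) * e * n ≤ n * e * r := by gcongr
      have h3 : (0 : ℝ) ≤ n * e * r := by positivity
      have h4 : (0 : ℝ) ≤ H n := by positivity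
      nlinarith
  have hup : ∀ n : ℕ, 2 * (H n : ℝ) ≤ (n : ℝ) ^ 2 * e + n * e := fun n => by
    have h1 : ((2 * H n : ℕ) : ℝ) ≤ (n * (n + 1) * e : ℕ) := by exact_mod_cast h.upper n
    push_cast at h1
    linarith
  have t1 : Tendsto (fun n : ℕ => (e : ℝ) - (2 * r * e) / n) atTop (nhds (e - 0)) :=
    tendsto_const_nhds.sub (tendsto_const_div_atTop_nhds_zero_nat _)
  have t2 : Tendsto (fun n : ℕ => (e : ℝ) + e / n) atTop (nhds (e + 0)) :=
    tendsto_const_nhds.add (tendsto_const_div_atTop_nhds_zero_nat _)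
  rw [sub_zero] at t1
  rw [add_zero] at t2
  refine tendsto_of_tendsto_of_tendsto_of_le_of_le' t1 t2 ?_ ?_
  · filter_upwards [eventually_gt_atTop 0] with n hn
    have hn' : (0 : ℝ) < n := by exact_mod_cast hn
    rw [le_div_iff₀ (by positivity)]
    refine le_trans (le_of_eq ?_) (hlow n)
    field_simp
  · filter_upwards [eventually_gt_atTop 0] with n hn
    have hn' : (0 : ℝ) < n := by exact_mod_cast hn
    rw [div_le_iff₀ (by positivity)]
    refine (hup n).trans (le_of_eq ?_)
    field_simp

theorem dim_eq_two {R : Type*} [CommRing R] (hdim : ringKrullDim R = 2) : dim R = 2 := by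
  unfold dim
  rw [hdim]
  rfl

theorem HilbertBound.hsMultiplicity_pow {e r : ℕ} (hdim : ringKrullDim R = 2)
    (h : HilbertBound (fun n => (colength (maximalIdeal R ^ n)).toNat) e r) {k : ℕ} (hk : 1 ≤ k) :
    hsMultiplicity (maximalIdeal R ^ k) = (k : ℝ) ^ 2 * e := by
  unfold hsMultiplicity
  rw [dim_eq_two hdim]
  apply Tendsto.limUnder_eq
  -- The sequence for 𝔪^k is k² times the subsequence of the one for 𝔪 along multiples of k.
  have h1 := (h.tendsto.comp (tendsto_id.const_mul_atTop' hk)).const_mul ((k : ℝ) ^ 2)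
  refine h1.congr fun n => ?_
  have hk' : (k : ℝ) ≠ 0 := by exact_mod_cast (by omega : k ≠ 0)
  change _ = ((Nat.factorial 2 : ℕ) : ℝ) *
    ((colength ((maximalIdeal R ^ k) ^ n)).toNat : ℝ) / (n : ℝ) ^ 2
  rw [← pow_mul]
  simp only [Function.comp_apply, id, Nat.factorial_two]
  push_cast
  rw [mul_pow]
  by_cases hn : (n : ℝ) = 0
  · simp [hn]
  · field_simp

theorem colength_toNat_succ [IsNoetherianRing R] (n : ℕ) :
    (colength (maximalIdeal R ^ (n + 1))).toNat =
      (colength (maximalIdeal R ^ n)).toNat + numGens (maximalIdeal R ^ n) := by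
  rw [colength_pow_succ, ENat.toNat_add (colength_ne_top_of_pow_le le_rfl) (ENat.natCast_ne_top _),
    ENat.toNat_natCast]

/-- Cancelling n in (μ - 1)n ≥ n²e leaves μ ≥ ne + 1, and `succ_le` supplies the reverse bound. -/
theorem HilbertBound.inequalityA_iff [IsNoetherianRing R] {e r : ℕ} (hdim : ringKrullDim R = 2)
    (h : HilbertBound (fun n => (colength (maximalIdeal R ^ n)).toNat) e r) {n : ℕ} (hn : 1 ≤ n)
    (hl : loewyLength (maximalIdeal R ^ n) = n) :
    InequalityA (maximalIdeal R ^ n) ↔ numGens (maximalIdeal R ^ n) = n * e + 1 := by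
  have hle : numGens (maximalIdeal R ^ n) ≤ n * e + 1 := by
    have := h.succ_le n
    rw [colength_toNat_succ] at this
    omega
  have hn' : (0 : ℝ) < n := by exact_mod_cast hn
  unfold InequalityA
  rw [dim_eq_two hdim, hl, h.hsMultiplicity_pow hdim hn]
  simp only [Nat.add_one_sub_one, Nat.factorial_one, Nat.cast_one, one_mul, Nat.cast_ofNat]
  have h1 : ((numGens (maximalIdeal R ^ n) : ℝ) - 2 + 1) * n ≥ (n : ℝ) ^ 2 * e ↔
      (n * e + 1 : ℝ) ≤ numGens (maximalIdeal R ^ n) := by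
    rw [ge_iff_le, show (n : ℝ) ^ 2 * e = n * e * n by ring, mul_le_mul_iff_left₀ hn']
    constructor <;> intro h <;> linarith
  rw [h1]
  constructor
  · intro h2
    exact le_antisymm hle (by exact_mod_cast h2)
  · intro h2
    rw [h2]
    push_cast
    exact le_rfl

end Main

end LechIneq

theorem mainTheorem9 (R : Type*) [CommRing R] [IsLocalRing R] [IsNoetherianRing R]
    (hCM : LechIneq.IsCohenMacaulay R) (hdim : ringKrullDim R = 2) :
    List.TFAE [
      LechIneq.HasMinimalMultiplicity R,
      ∀ n : ℕ, 1 ≤ n → LechIneq.InequalityA (IsLocalRing.maximalIdeal R ^ n),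
      {n : ℕ | 1 ≤ n ∧ LechIneq.InequalityA (IsLocalRing.maximalIdeal R ^ n)}.Infinite] := by
  open LechIneq in
  obtain ⟨x, hx, y, hy, hreg, N, hN⟩ := exists_weaklyRegular_pair hCM hdim
  obtain ⟨e, r, h⟩ := exists_hilbertBound hreg hx hy hN
  have hineq : ∀ n, 1 ≤ n → (InequalityA (maximalIdeal R ^ n) ↔
      numGens (maximalIdeal R ^ n) = n * e + 1) := fun n hn =>
    h.inequalityA_iff hdim hn ((isRegularPair_of_isWeaklyRegular hreg).loewyLength_pow hx n)
  have hsucc : ∀ n, (colength (maximalIdeal R ^ (n + 1))).toNat =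
      (colength (maximalIdeal R ^ n)).toNat + n * e + 1 ↔
      numGens (maximalIdeal R ^ n) = n * e + 1 := fun n => by
    rw [colength_toNat_succ]
    omega
  have hmin : HasMinimalMultiplicity R ↔ numGens (maximalIdeal R ^ 1) = 1 * e + 1 := by
    have h1 := h.hsMultiplicity_pow hdim le_rfl
    rw [pow_one] at h1 ⊢
    unfold HasMinimalMultiplicity
    rw [h1, dim_eq_two hdim, ← @Nat.cast_inj ℝ]
    push_cast
    constructor <;> intro h <;> linarith
  tfae_have 1 → 2 := fun h1 n hn =>
    (hineq n hn).2 ((hsucc n).1 (h.eq_of_two (by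
      have := (hsucc 1).2 (hmin.1 h1)
      rwa [one_mul] at this) n))
  tfae_have 2 → 3 := fun h2 => by
    refine (Set.Ici_infinite 1).mono fun n hn => ⟨hn, h2 n hn⟩
  tfae_have 3 → 1 := fun h3 => hmin.2 <| (hsucc 1).1 <| h.eq_of_frequently (fun N => by
    obtain ⟨n, ⟨hn1, hn⟩, hN⟩ := h3.exists_gt N
    exact ⟨n, hN.le, (hsucc n).2 ((hineq n hn1).1 hn)⟩) 1
  tfae_finish
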